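/- Let $\ell>0$ and let $\mu$ be a measurable rate function on $(0,\infty)$ with $\mu(t)>0$ for Lebesgue-almost all $t>0$. Write $M(a,b)=\int_a^b\mu(s)\,\mathrm{d}s$ and assume $M(0,t)<\infty$ for all $t<\infty$. Let $\mathcal N$ be an inhomogeneous Poisson point process on $(0,\infty)$ with rate function $\mu$ and epochs $0<T_1<T_2<\cdots$; put $T_0=0$, and $T_{n+1}=\infty$ if there is no epoch after $T_n<\infty$. Let $$D=\min\{T_n:\ T_n<\infty,\ T_{n+1}-T_n\ge\ell\}\in[0,\infty]\qquad(\min\emptyset=\infty)$$ be the time at which the first gap of length at least $\ell$ begins. Then $\mathbb P(D>t)>0$ for all $t$, and, with all limits taken as $t\to\infty$, the following hold. (i) If $\mu(t)\to\infty$, then $\mathbb P(D>t+u)/\mathbb P(D>t)\to1$ for every $u>0$, i.e. $D$ is long-tailed. Moreover, if $\liminf M(t,t+\ell-\varepsilon)>0$ for some $\varepsilon>0$ (where $M(a,b)=0$ if $a\ge b$), then $\liminf\mathbb P(D>t+u)/\mathbb P(D>t)>0$ for every $u>0$. (ii) If $\mu(t)\to0$, then $\mathbb P(D>t+u)/\mathbb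 P(D>t)\to0$ for every $u\ge\ell$. Moreover, if $\limsup M(t,t+\ell)<\infty$, then $\limsup\mathbb P(D>t+u)/\mathbb P(D>t)<1$ for every $u\ge\ell$. -/

import Mathlib

open Filter Topology MeasureTheory ProbabilityTheory Set
open scoped ENNReal

noncomputable section

/-- The intensity measure `M(dt) = μ(t) dt` on `(0, ∞)` with rate function `μ`
(regarded as a measure on `ℝ` that vanishes outside `(0, ∞)`). -/
def intensity (μ : ℝ → ℝ) : Measure ℝ :=
  (volume.restrict (Ioi (0 : ℝ))).withDensity (fun t => ENNReal.ofReal (μ t))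

/-- The random set `N ⊆ (0, ∞)` is, under the probability `P`, a Poisson point process with
intensity measure `M`: the number of points in a Borel set `B` with `M B < ∞` is Poisson
distributed with mean `M B`, and the numbers of points in finitely many pairwise disjoint Borel
sets are independent. -/
structure IsPoissonProcess {Ω : Type*} [MeasurableSpace Ω] (P : Measure Ω)
    (N : Ω → Set ℝ) (M : Measure ℝ) : Prop where
  subset_Ioi : ∀ ω, N ω ⊆ Ioi 0
  measurable_count : ∀ B : Set ℝ, MeasurableSet B → Measurable (fun ω => (N ω ∩ B).encard)
  law_count : ∀ B : Set ℝ, MeasurableSet B → M B ≠ ∞ → ∀ k : ℕ,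
    P {ω | (N ω ∩ B).encard = k} = poissonMeasure (M B).toNNReal {k}
  indep_count : ∀ (n : ℕ) (B : Fin n → Set ℝ), (∀ i, MeasurableSet (B i)) →
    Pairwise (fun i j => Disjoint (B i) (B j)) →
    iIndepFun (fun i ω => (N ω ∩ B i).encard) P

/-- The epochs `T₀ = 0 < T₁ < T₂ < ⋯` of a locally finite set `S` of positive reals: `T₍ₙ₊₁₎` is
the first point of `S` after `Tₙ`, and is `∞` if there is none. -/
def epoch (S : Set ℝ) : ℕ → EReal
  | 0 => 0
  | n + 1 => sInf {x : EReal | ∃ s ∈ S, x = (s : EReal) ∧ epoch S n < (s : EReal)}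

/-- The time `D = min {Tₙ : T₍ₙ₊₁₎ - Tₙ ≥ ℓ}` at which the first gap of length at least `ℓ`
begins; it is `∞` if there is no such gap. -/
def firstGap (ℓ : ℝ) (S : Set ℝ) : EReal :=
  sInf {x : EReal | ∃ n : ℕ, x = epoch S n ∧ epoch S n < ⊤ ∧
    epoch S n + (ℓ : EReal) ≤ epoch S (n + 1)}

/-- The ratio `ℙ(D > t + u) / ℙ(D > t)`, where `D` is the time of the first gap of length `ℓ`
of the random set `N`. -/
def tailRatio {Ω : Type*} [MeasurableSpace Ω] (P : Measure Ω) (N : Ω → Set ℝ) (ℓ u t : ℝ) : ℝ≥0∞ :=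
  P {ω | ((t + u : ℝ) : EReal) < firstGap ℓ (N ω)} / P {ω | (t : EReal) < firstGap ℓ (N ω)}

end

/-! For a locally finite set of points, `D > t` means that every open interval `(y, y + ℓ)` with `0
≤ y ≤ t` contains a point. This event `Fills ℓ t` is increasing in the set of points and depends
only on the points in `(0, t + ℓ)`.

Lower bound on the ratio: to pass from `t` to `t + u` it is enough to hit finitely many intervals of
length `ℓ - ε` on a grid of mesh `ε`. Hitting a set is positively correlated with any increasing
event, so the ratio is at least `∏ (1 - exp (-M J))` over these intervals
(`mul_prod_le_real_fills`), with a number of factors independent of `t`.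

Upper bound, for `u ≥ ℓ`: surviving to `t + u` forces a point in `(t + ℓ, t + 2ℓ)`, independently of
survival to `t`, so the ratio is at most `1 - exp (-M(t + ℓ, t + 2ℓ))` (`real_fills_add_le`).

An eventual bound `c` on the interval masses turns these into bounds in `c` alone: the two limits
let `c → ∞` or `c → 0`, the two weaker claims fix `c`. -/

/-! ### Deterministic part: gaps, epochs and filled intervals. -/

/-- Every open interval of length `ℓ` with left endpoint in `[0, t]` contains a point of `S`. -/
def Fills (ℓ t : ℝ) (S : Set ℝ) : Prop :=
  ∀ y ∈ Icc 0 t, (S ∩ Ioo y (y + ℓ)).Nonempty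

lemma Fills.mono {ℓ t : ℝ} {S S' : Set ℝ} (h : S ⊆ S') (hS : Fills ℓ t S) : Fills ℓ t S' :=
  fun y hy => (hS y hy).mono (inter_subset_inter_left _ h)

lemma Fills.anti {ℓ s t : ℝ} {S : Set ℝ} (h : s ≤ t) (hS : Fills ℓ t S) : Fills ℓ s S :=
  fun y hy => hS y ⟨hy.1, hy.2.trans h⟩

lemma fills_inter_Ioo {ℓ t : ℝ} {S : Set ℝ} :
    Fills ℓ t (S ∩ Ioo 0 (t + ℓ)) ↔ Fills ℓ t S := by
  refine ⟨Fills.mono inter_subset_left, fun h y hy => ?_⟩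
  obtain ⟨s, hs, hs'⟩ := h y hy
  exact ⟨s, ⟨hs, hy.1.trans_lt hs'.1, hs'.2.trans_le (by linarith [hy.2])⟩, hs'⟩

/-- `Fills` in terms of countably many intervals. -/
lemma fills_iff_rat {ℓ t : ℝ} {S : Set ℝ} :
    Fills ℓ t S ↔ ∃ n : ℕ, ∀ q : ℚ, (q : ℝ) ∈ Icc 0 (t + 1 / ((n : ℝ) + 1)) →
      (S ∩ Ioo (q : ℝ) (q + ℓ - 1 / ((n : ℝ) + 1))).Nonempty := by
  constructor
  · intro h
    by_contra! hcon
    -- Compactness: counterexamples for every margin `1 / (n + 1)` accumulate at some `y ∈ [0, t]`,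
    -- and a point of `S` in `(y, y + ℓ)` lies in the shrunken intervals near `y`.
    choose q hq hqS using hcon
    have hmem : ∀ n, (q n : ℝ) ∈ Icc 0 (t + 1) := fun n =>
      ⟨(hq n).1, (hq n).2.trans (by
        have : 1 / ((n : ℝ) + 1) ≤ 1 := by
          rw [div_le_one (by positivity)]; linarith [(Nat.cast_nonneg n : (0 : ℝ) ≤ n)]
        linarith)⟩
    obtain ⟨y, hy, φ, hφ, hlim⟩ := isCompact_Icc.tendsto_subseq hmem
    have h0 : Tendsto (fun n => 1 / ((φ n : ℝ) + 1)) atTop (𝓝 0) :=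
      tendsto_one_div_add_atTop_nhds_zero_nat.comp hφ.tendsto_atTop
    have hyt : y ≤ t := by
      have := le_of_tendsto_of_tendsto' hlim (h0.const_add t) fun n => (hq (φ n)).2
      simpa using this
    obtain ⟨s, hs, hs1, hs2⟩ := h y ⟨hy.1, hyt⟩
    have e1 := hlim.eventually (gt_mem_nhds hs1)
    have h2 : Tendsto (fun n => (q (φ n) : ℝ) + ℓ - 1 / ((φ n : ℝ) + 1)) atTop (𝓝 (y + ℓ)) := by
      simpa using (hlim.add_const ℓ).sub h0
    have e2 := h2.eventually (lt_mem_nhds hs2)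
    obtain ⟨n, hn1, hn2⟩ := (e1.and e2).exists
    exact (Set.eq_empty_iff_forall_notMem.1 (hqS (φ n))) s ⟨hs, hn1, hn2⟩
  · rintro ⟨n, h⟩ y hy
    have hn : 0 < 1 / ((n : ℝ) + 1) := by positivity
    obtain ⟨q, hq1, hq2⟩ := exists_rat_btwn (show y < y + 1 / ((n : ℝ) + 1) by linarith)
    obtain ⟨s, hs, hs1, hs2⟩ := h q ⟨by linarith [hy.1], by linarith [hy.2]⟩
    exact ⟨s, hs, by linarith, by linarith⟩

/-- If every open interval of length `ℓ` starting in `[0, t]` is hit, then so is every such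
interval starting slightly after `t`. -/
lemma Fills.exists_gt {ℓ t : ℝ} {S : Set ℝ} (h : Fills ℓ t S) : ∃ t' > t, Fills ℓ t' S := by
  obtain ⟨n, hn⟩ := fills_iff_rat.1 h
  have hp : 0 < 1 / ((n : ℝ) + 1) := by positivity
  refine ⟨t + 1 / ((n : ℝ) + 1) / 2, by linarith, fun y hy => ?_⟩
  obtain ⟨q, hq1, hq2⟩ := exists_rat_btwn (show y < y + 1 / ((n : ℝ) + 1) / 2 by linarith)
  obtain ⟨s, hs, hs1, hs2⟩ := hn q ⟨by linarith [hy.1], by linarith [hy.2]⟩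
  exact ⟨s, hs, by linarith, by linarith⟩

lemma epoch_nonneg (S : Set ℝ) : ∀ n, 0 ≤ epoch S n
  | 0 => le_rfl
  | n + 1 => le_sInf (by
      rintro x ⟨s, -, rfl, hs⟩
      exact (epoch_nonneg S n).trans hs.le)

lemma epoch_succ_le {S : Set ℝ} {n : ℕ} {s : ℝ} (hs : s ∈ S) (h : epoch S n < (s : EReal)) :
    epoch S (n + 1) ≤ s :=
  sInf_le ⟨s, hs, rfl, h⟩

lemma lt_firstGap_of_fills {ℓ t : ℝ} {S : Set ℝ} (h : Fills ℓ t S) :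
    (t : EReal) < firstGap ℓ S := by
  -- The room beyond `t` makes the inequality strict, since `firstGap` is an infimum.
  obtain ⟨t', htt, h'⟩ := h.exists_gt
  refine (EReal.coe_lt_coe_iff.2 htt).trans_le (le_sInf ?_)
  rintro x ⟨n, rfl, hlt, hgap⟩
  by_contra! hcon
  have h0 := epoch_nonneg S n
  lift epoch S n to ℝ using ⟨hlt.ne, (EReal.bot_lt_zero.trans_le h0).ne'⟩ with x hx
  obtain ⟨s, hs, hs1, hs2⟩ := h' x ⟨by exact_mod_cast h0, by exact_mod_cast hcon.le⟩
  have := epoch_succ_le (n := n) hs (by rw [← hx]; exact_mod_cast hs1)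
  have h3 := hgap.trans this
  rw [← EReal.coe_add, EReal.coe_le_coe_iff] at h3
  linarith

/-- In a locally finite set, an epoch that is not `∞` is attained. -/
lemma exists_epoch_succ_eq {S : Set ℝ} (hS : S ⊆ Ioi 0) (hfin : ∀ n : ℕ, (S ∩ Ioo 0 (n : ℝ)).Finite)
    {n : ℕ} {y : ℝ} (h : epoch S (n + 1) ≤ y) :
    ∃ s ∈ S, epoch S (n + 1) = s ∧ epoch S n < s := by
  obtain ⟨m, hm⟩ := exists_nat_gt (y + 1)
  set A : Set ℝ := {s ∈ S ∩ Ioo 0 (m : ℝ) | epoch S n < (s : EReal)} with hA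
  have hAfin : A.Finite := (hfin m).subset (sep_subset _ _)
  have hlt : epoch S (n + 1) < ((m : ℝ) : EReal) :=
    h.trans_lt (EReal.coe_lt_coe_iff.2 (by linarith))
  obtain ⟨x, ⟨s, hs, rfl, hns⟩, hsm⟩ := sInf_lt_iff.1 hlt
  have hAne : A.Nonempty := ⟨s, ⟨hs, hS hs, EReal.coe_lt_coe_iff.1 hsm⟩, hns⟩
  obtain ⟨a, ⟨⟨haS, ham⟩, han⟩, hmin⟩ := hAfin.exists_minimal hAne
  refine ⟨a, haS, le_antisymm (epoch_succ_le haS han) (le_sInf ?_), han⟩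
  rintro x ⟨b, hb, rfl, hnb⟩
  rw [EReal.coe_le_coe_iff]
  by_contra! hba
  exact hba.not_ge (hmin ⟨⟨hb, hS hb, hba.trans ham.2⟩, hnb⟩ hba.le)

/-- In a locally finite set, every `y ≥ 0` lies between two successive epochs. -/
lemma exists_epoch_le_lt {S : Set ℝ} (hS : S ⊆ Ioi 0)
    (hfin : ∀ n : ℕ, (S ∩ Ioo 0 (n : ℝ)).Finite) {y : ℝ} (hy : 0 ≤ y) :
    ∃ n, epoch S n ≤ y ∧ (y : EReal) < epoch S (n + 1) := by
  by_contra! hcon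
  have hle : ∀ n, epoch S n ≤ y := fun n => by
    induction n with
    | zero => exact EReal.coe_nonneg.2 hy
    | succ n ih => exact hcon n ih
  choose s hsS hs hlt using fun n => exists_epoch_succ_eq hS hfin (hle (n + 1))
  have hmono : StrictMono s := strictMono_nat_of_lt_succ fun n => by
    have := hlt (n + 1)
    rw [hs n] at this
    exact_mod_cast this
  obtain ⟨m, hm⟩ := exists_nat_gt y
  -- Epochs that never exceed `y` would be infinitely many points in a bounded interval.
  refine infinite_range_of_injective hmono.injective ((hfin m).subset ?_)
  rintro _ ⟨n, rfl⟩
  refine ⟨hsS n, hS (hsS n), lt_of_le_of_lt ?_ hm⟩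
  have := hle (n + 1)
  rw [hs n] at this
  exact_mod_cast this

/-- An empty `(y, y + ℓ)` lies in a gap that begins at the last epoch not after `y`, hence no later
than `t`. -/
lemma fills_of_lt_firstGap {ℓ t : ℝ} {S : Set ℝ} (hS : S ⊆ Ioi 0)
    (hfin : ∀ n : ℕ, (S ∩ Ioo 0 (n : ℝ)).Finite) (h : (t : EReal) < firstGap ℓ S) :
    Fills ℓ t S := by
  intro y hy
  by_contra! hcon
  obtain ⟨n, hn1, hn2⟩ := exists_epoch_le_lt hS hfin hy.1
  have hgap : epoch S n + (ℓ : EReal) ≤ epoch S (n + 1) := by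
    refine le_trans (add_le_add_left hn1 _) (le_sInf ?_)
    rintro x ⟨s, hs, rfl, hns⟩
    have hys : y < s := by exact_mod_cast hn2.trans_le (epoch_succ_le hs hns)
    rw [← EReal.coe_add, EReal.coe_le_coe_iff]
    by_contra! hlt
    exact Set.eq_empty_iff_forall_notMem.1 hcon s ⟨hs, hys, hlt⟩
  have hD : firstGap ℓ S ≤ epoch S n :=
    sInf_le ⟨n, rfl, hn1.trans_lt (EReal.coe_lt_top y), hgap⟩
  exact h.not_ge (hD.trans (hn1.trans (EReal.coe_le_coe_iff.2 hy.2)))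

/-- Rounding `y` up to the grid moves it by less than `ε`, so the interval of length `ℓ - ε` at the
grid point stays inside `(y, y + ℓ)`. The indices run from `0` to `⌈u / ε⌉` inclusive. -/
lemma fills_add_of_forall_hit {ℓ ε t u : ℝ} {S : Set ℝ} (hε : 0 < ε) (ht : Fills ℓ t S)
    (h : ∀ k ∈ Finset.range (⌈u / ε⌉₊ + 1),
      (S ∩ Ioo (t + k * ε) (t + k * ε + ℓ - ε)).Nonempty) :
    Fills ℓ (t + u) S := by
  intro y hy
  rcases le_total y t with hyt | hyt
  · exact ht y ⟨hy.1, hyt⟩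
  · have h1 : ⌈(y - t) / ε⌉₊ ≤ ⌈u / ε⌉₊ :=
      Nat.ceil_mono (by gcongr; linarith [hy.2])
    obtain ⟨s, hs, hs1, hs2⟩ := h ⌈(y - t) / ε⌉₊ (Finset.mem_range.2 (by omega))
    have h2 := Nat.le_ceil ((y - t) / ε)
    have h3 := Nat.ceil_lt_add_one (show 0 ≤ (y - t) / ε from div_nonneg (by linarith) hε.le)
    rw [div_le_iff₀ hε] at h2
    rw [← sub_lt_iff_lt_add, lt_div_iff₀ hε] at h3
    exact ⟨s, hs, by linarith, by linarith⟩

/-! ### Independence and correlation inequalities for the Poisson process. -/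

section Poisson

variable {Ω : Type*}

/-- The event that the random set `N` has no point in `B`. -/
def avoid (N : Ω → Set ℝ) (B : Set ℝ) : Set Ω := {ω | N ω ∩ B = ∅}

/-- The avoidance events of the Borel subsets of `C` with finite intensity. -/
def avoidEvents (N : Ω → Set ℝ) (M : Measure ℝ) (C : Set ℝ) : Set (Set Ω) :=
  {s | ∃ B ⊆ C, MeasurableSet B ∧ M B ≠ ∞ ∧ s = avoid N B}

/-- The σ-algebra generated by the random set `N` inside `C`. -/
@[reducible]
def avoidSigma (N : Ω → Set ℝ) (M : Measure ℝ) (C : Set ℝ) : MeasurableSpace Ω :=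
  MeasurableSpace.generateFrom (avoidEvents N M C)

lemma avoid_union (N : Ω → Set ℝ) (A B : Set ℝ) : avoid N (A ∪ B) = avoid N A ∩ avoid N B := by
  ext ω
  simp [avoid, inter_union_distrib_left]

lemma isPiSystem_avoidEvents (N : Ω → Set ℝ) (M : Measure ℝ) (C : Set ℝ) :
    IsPiSystem (avoidEvents N M C) := by
  rintro _ ⟨A, hA, hAm, hAf, rfl⟩ _ ⟨B, hB, hBm, hBf, rfl⟩ -
  exact ⟨A ∪ B, union_subset hA hB, hAm.union hBm, by simp [measure_union_ne_top hAf hBf],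
    (avoid_union N A B).symm⟩

lemma measurableSet_avoidSigma {N : Ω → Set ℝ} {M : Measure ℝ} {B C : Set ℝ} (h : B ⊆ C)
    (hB : MeasurableSet B) (hf : M B ≠ ∞) : MeasurableSet[avoidSigma N M C] (avoid N B) :=
  MeasurableSpace.measurableSet_generateFrom ⟨B, h, hB, hf, rfl⟩

/-- A family of sets that is closed under adding points and whose membership is decided, inside
any `C`, by the avoidance events of `C`. -/
structure IsIncreasingEvent (N : Ω → Set ℝ) (M : Measure ℝ) (U : Set (Set ℝ)) : Prop where
  isUpperSet : IsUpperSet U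
  measurableSet : ∀ C, MeasurableSet C → MeasurableSet[avoidSigma N M C] {ω | N ω ∩ C ∈ U}

namespace IsIncreasingEvent

variable {N : Ω → Set ℝ} {M : Measure ℝ} {U V : Set (Set ℝ)}

lemma hit {B : Set ℝ} (hB : MeasurableSet B) (hf : M B ≠ ∞) :
    IsIncreasingEvent N M {S | (S ∩ B).Nonempty} where
  isUpperSet := fun _ _ h hS => hS.mono (inter_subset_inter_left _ h)
  measurableSet C hC := by
    have := (measurableSet_avoidSigma (N := N) (M := M) (inter_subset_left : C ∩ B ⊆ C)
      (hC.inter hB) (ne_top_of_le_ne_top hf (measure_mono inter_subset_right))).compl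
    convert this using 1
    ext ω
    simp [avoid, inter_assoc, nonempty_iff_ne_empty]

lemma inter (hU : IsIncreasingEvent N M U) (hV : IsIncreasingEvent N M V) :
    IsIncreasingEvent N M (U ∩ V) where
  isUpperSet := hU.isUpperSet.inter hV.isUpperSet
  measurableSet C hC := (hU.measurableSet C hC).inter (hV.measurableSet C hC)

lemma iInter {ι : Sort*} [Countable ι] {U : ι → Set (Set ℝ)}
    (hU : ∀ i, IsIncreasingEvent N M (U i)) : IsIncreasingEvent N M (⋂ i, U i) where
  isUpperSet := isUpperSet_iInter fun i => (hU i).isUpperSet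
  measurableSet C hC := by
    have := MeasurableSet.iInter fun i => (hU i).measurableSet C hC
    simpa only [mem_iInter, ofPred_forall] using this

lemma iUnion {ι : Sort*} [Countable ι] {U : ι → Set (Set ℝ)}
    (hU : ∀ i, IsIncreasingEvent N M (U i)) : IsIncreasingEvent N M (⋃ i, U i) where
  isUpperSet := isUpperSet_iUnion fun i => (hU i).isUpperSet
  measurableSet C hC := by
    have := MeasurableSet.iUnion fun i => (hU i).measurableSet C hC
    simpa only [mem_iUnion, ofPred_exists] using this

lemma hits {ι : Type*} (s : Finset ι) {J : ι → Set ℝ} (hU : IsIncreasingEvent N M U)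
    (hJ : ∀ i, MeasurableSet (J i)) (hf : ∀ i, M (J i) ≠ ∞) :
    IsIncreasingEvent N M (U ∩ {S | ∀ i ∈ s, (S ∩ J i).Nonempty}) := by
  classical
  induction s using Finset.induction_on with
  | empty => simpa using hU
  | insert a s ha ih =>
    convert (hit (hJ a) (hf a)).inter ih using 1
    ext S
    simp; tauto

/-- The rational description with a margin replaces uncountably many intervals by countable unions
and intersections of hitting events. -/
lemma fills (hf : ∀ a b : ℝ, M (Ioo a b) ≠ ∞) (ℓ t : ℝ) :
    IsIncreasingEvent N M {S | Fills ℓ t S} := by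
  have : {S | Fills ℓ t S} = ⋃ n : ℕ, ⋂ q : ℚ, ⋂ _ : (q : ℝ) ∈ Icc 0 (t + 1 / ((n : ℝ) + 1)),
      {S | (S ∩ Ioo (q : ℝ) (q + ℓ - 1 / ((n : ℝ) + 1))).Nonempty} := by
    ext S
    simp only [mem_iUnion, mem_iInter, mem_ofPred_eq, fills_iff_rat]
  rw [this]
  exact iUnion fun n => iInter fun q => iInter fun _ => hit measurableSet_Ioo (hf _ _)

end IsIncreasingEvent

variable [MeasurableSpace Ω]

namespace IsPoissonProcess

variable {P : Measure Ω} {N : Ω → Set ℝ} {M : Measure ℝ}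

lemma measurableSet_avoid (hN : IsPoissonProcess P N M) {B : Set ℝ} (hB : MeasurableSet B) :
    MeasurableSet (avoid N B) := by
  have := hN.measurable_count B hB (measurableSet_singleton 0)
  simpa [avoid, preimage] using this

lemma measure_avoid (hN : IsPoissonProcess P N M) {B : Set ℝ} (hB : MeasurableSet B)
    (hf : M B ≠ ∞) : P (avoid N B) = ENNReal.ofReal (Real.exp (-(M B).toReal)) := by
  have := hN.law_count B hB hf 0
  simpa [avoid, poissonMeasure_singleton, ENNReal.coe_toNNReal_eq_toReal] using this

lemma real_avoid (hN : IsPoissonProcess P N M) {B : Set ℝ} (hB : MeasurableSet B)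
    (hf : M B ≠ ∞) : P.real (avoid N B) = Real.exp (-(M B).toReal) := by
  rw [measureReal_def, hN.measure_avoid hB hf, ENNReal.toReal_ofReal (Real.exp_nonneg _)]

lemma avoidSigma_le (hN : IsPoissonProcess P N M) (C : Set ℝ) :
    avoidSigma N M C ≤ ‹MeasurableSpace Ω› := by
  refine MeasurableSpace.generateFrom_le ?_
  rintro _ ⟨B, -, hB, -, rfl⟩
  exact hN.measurableSet_avoid hB

/-- The restrictions of a Poisson process to disjoint sets are independent. -/
lemma indep_avoidSigma [IsProbabilityMeasure P] (hN : IsPoissonProcess P N M) {C C' : Set ℝ}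
    (h : Disjoint C C') : Indep (avoidSigma N M C) (avoidSigma N M C') P := by
  refine IndepSets.indep (hN.avoidSigma_le C) (hN.avoidSigma_le C') (isPiSystem_avoidEvents N M C)
    (isPiSystem_avoidEvents N M C') rfl rfl ((IndepSets_iff _ _ _).2 ?_)
  rintro _ _ ⟨A, hA, hAm, hAf, rfl⟩ ⟨B, hB, hBm, hBf, rfl⟩
  -- Void probabilities `exp (-M B)` multiply over disjoint sets, and avoidance events form a
  -- π-system.
  rw [← avoid_union, hN.measure_avoid (hAm.union hBm) (measure_union_ne_top hAf hBf),
    hN.measure_avoid hAm hAf, hN.measure_avoid hBm hBf, measure_union (h.mono hA hB) hBm,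
    ENNReal.toReal_add hAf hBf, neg_add, Real.exp_add, ENNReal.ofReal_mul (Real.exp_nonneg _)]

/-- The Poisson weights of the finite counts already sum to one. -/
lemma ae_finite [IsProbabilityMeasure P] (hN : IsPoissonProcess P N M) {B : Set ℝ}
    (hB : MeasurableSet B) (hf : M B ≠ ∞) : ∀ᵐ ω ∂P, (N ω ∩ B).Finite := by
  have hk : ∀ k : ℕ, MeasurableSet {ω | (N ω ∩ B).encard = k} := fun k =>
    hN.measurable_count B hB (measurableSet_singleton (k : ℕ∞))
  have hU : {ω | (N ω ∩ B).Finite} = ⋃ k : ℕ, {ω | (N ω ∩ B).encard = k} := by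
    ext ω
    simp only [mem_ofPred_eq, mem_iUnion, ← encard_ne_top_iff, ENat.ne_top_iff_exists, eq_comm]
  have hd : Pairwise (Function.onFun Disjoint fun k : ℕ => {ω | (N ω ∩ B).encard = k}) :=
    fun i j hij => Set.disjoint_left.2 fun ω (hi : _ = _) (hj : _ = _) =>
      hij (by exact_mod_cast hi.symm.trans hj)
  have hm : MeasurableSet {ω | (N ω ∩ B).Finite} := hU ▸ MeasurableSet.iUnion hk
  refine (mem_ae_iff_prob_eq_one hm).2 ?_
  rw [hU, measure_iUnion hd hk]
  simp_rw [hN.law_count B hB hf]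
  rw [← measure_iUnion (fun i j hij => by simpa using hij) fun _ => measurableSet_singleton _,
    iUnion_of_singleton]
  exact measure_univ

end IsPoissonProcess

namespace IsIncreasingEvent

variable {P : Measure Ω} {N : Ω → Set ℝ} {M : Measure ℝ} {U : Set (Set ℝ)}

/-- Increasing events and avoidance events are negatively correlated. -/
lemma real_inter_avoid_le [IsProbabilityMeasure P] (hN : IsPoissonProcess P N M)
    (hU : IsIncreasingEvent N M U) {J : Set ℝ} (hJ : MeasurableSet J) (hf : M J ≠ ∞) :
    P.real ({ω | N ω ∈ U} ∩ avoid N J) ≤ P.real {ω | N ω ∈ U} * P.real (avoid N J) := by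
  -- When `J` is empty of points, `U` is decided by `Jᶜ`, independently of `J`; adding back the
  -- points of `J` only helps `U`.
  have h1 : {ω | N ω ∈ U} ∩ avoid N J = {ω | N ω ∩ Jᶜ ∈ U} ∩ avoid N J := by
    ext ω
    refine and_congr_left fun h => ?_
    have : N ω ∩ Jᶜ = N ω := inter_eq_left.2 (disjoint_iff_inter_eq_empty.2 h).subset_compl_right
    simp [this]
  have h2 := (Indep_iff _ _ _).1 (hN.indep_avoidSigma (disjoint_compl_left : Disjoint Jᶜ J)) _ _
    (hU.measurableSet Jᶜ hJ.compl) (measurableSet_avoidSigma subset_rfl hJ hf)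
  rw [h1, measureReal_def, h2, ENNReal.toReal_mul]
  exact mul_le_mul_of_nonneg_right
    (measureReal_mono fun ω h => hU.isUpperSet inter_subset_left h) measureReal_nonneg

/-- Increasing events are positively correlated with hitting a given set. -/
lemma mul_le_real_inter_hit [IsProbabilityMeasure P] (hN : IsPoissonProcess P N M)
    (hU : IsIncreasingEvent N M U) {J : Set ℝ} (hJ : MeasurableSet J) (hf : M J ≠ ∞) :
    P.real {ω | N ω ∈ U} * (1 - Real.exp (-(M J).toReal)) ≤
      P.real {ω | N ω ∈ U ∩ {S | (S ∩ J).Nonempty}} := by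
  have h1 := hU.real_inter_avoid_le hN hJ hf
  have h2 := measureReal_inter_add_sdiff (μ := P) (s := {ω | N ω ∈ U}) (hN.measurableSet_avoid hJ)
  have h3 : {ω | N ω ∈ U} \ avoid N J = {ω | N ω ∈ U ∩ {S | (S ∩ J).Nonempty}} := by
    ext ω
    simp [avoid, nonempty_iff_ne_empty]
  rw [hN.real_avoid hJ hf] at h1
  rw [h3] at h2
  linarith

/-- Intersecting with a hitting event keeps the event increasing, so the one-set inequality
iterates; the `J i` may overlap. -/
lemma mul_prod_le_real_hits [IsProbabilityMeasure P] (hN : IsPoissonProcess P N M)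
    (hU : IsIncreasingEvent N M U) {ι : Type*} (s : Finset ι) {J : ι → Set ℝ}
    (hJ : ∀ i, MeasurableSet (J i)) (hf : ∀ i, M (J i) ≠ ∞) :
    P.real {ω | N ω ∈ U} * ∏ i ∈ s, (1 - Real.exp (-(M (J i)).toReal)) ≤
      P.real {ω | N ω ∈ U ∩ {S | ∀ i ∈ s, (S ∩ J i).Nonempty}} := by
  classical
  induction s using Finset.induction_on with
  | empty => simp
  | insert a s ha ih =>
    have h0 : 0 ≤ 1 - Real.exp (-(M (J a)).toReal) := by simp
    have h1 := (hU.hits s hJ hf).mul_le_real_inter_hit hN (hJ a) (hf a)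
    rw [Finset.prod_insert ha, mul_left_comm, mul_comm]
    refine (mul_le_mul_of_nonneg_right ih h0).trans (h1.trans_eq ?_)
    congr 1
    ext ω
    simp; tauto

end IsIncreasingEvent

namespace IsPoissonProcess

variable {P : Measure Ω} [IsProbabilityMeasure P] {N : Ω → Set ℝ} {M : Measure ℝ}

lemma mul_prod_le_real_fills (hN : IsPoissonProcess P N M) (hf : ∀ a b : ℝ, M (Ioo a b) ≠ ∞)
    (ℓ t u : ℝ) {ε : ℝ} (hε : 0 < ε) :
    P.real {ω | Fills ℓ t (N ω)} * ∏ k ∈ Finset.range (⌈u / ε⌉₊ + 1),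
        (1 - Real.exp (-(M (Ioo (t + k * ε) (t + k * ε + ℓ - ε))).toReal)) ≤
      P.real {ω | Fills ℓ (t + u) (N ω)} :=
  ((IsIncreasingEvent.fills hf ℓ t).mul_prod_le_real_hits hN _ (fun _ => measurableSet_Ioo)
    fun _ => hf _ _).trans
    (measureReal_mono fun _ h => fills_add_of_forall_hit hε h.1 h.2)

lemma real_fills_add_le (hN : IsPoissonProcess P N M) (hf : ∀ a b : ℝ, M (Ioo a b) ≠ ∞)
    {ℓ t u : ℝ} (ht : 0 ≤ t) (hℓ : 0 < ℓ) (hu : ℓ ≤ u) :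
    P.real {ω | Fills ℓ (t + u) (N ω)} ≤ P.real {ω | Fills ℓ t (N ω)} *
      (1 - Real.exp (-(M (Ioo (t + ℓ) (t + ℓ + ℓ))).toReal)) := by
  set J := Ioo (t + ℓ) (t + ℓ + ℓ)
  have hind := (Indep_iff _ _ _).1 (hN.indep_avoidSigma (C := Ioo 0 (t + ℓ)) (C' := J)
    (Set.disjoint_left.2 fun x hx hx' => (hx.2.trans hx'.1).false)) _ _
    ((IsIncreasingEvent.fills hf ℓ t).measurableSet _ measurableSet_Ioo)
    (measurableSet_avoidSigma subset_rfl measurableSet_Ioo (hf _ _))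
  simp only [mem_ofPred_eq, fills_inter_Ioo] at hind
  have hind' : P.real ({ω | Fills ℓ t (N ω)} ∩ avoid N J) =
      P.real {ω | Fills ℓ t (N ω)} * Real.exp (-(M J).toReal) := by
    rw [← hN.real_avoid measurableSet_Ioo (hf _ _), measureReal_def, hind, ENNReal.toReal_mul]
    rfl
  have h2 := measureReal_inter_add_sdiff (μ := P) (s := {ω | Fills ℓ t (N ω)})
    (hN.measurableSet_avoid (measurableSet_Ioo : MeasurableSet J))
  -- As `ℓ ≤ u`, the interval starting at `t + ℓ` is among those that must be hit.
  have h3 : {ω | Fills ℓ (t + u) (N ω)} ⊆ {ω | Fills ℓ t (N ω)} \ avoid N J := fun ω h =>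
    ⟨Fills.anti (by linarith) h, (h (t + ℓ) ⟨by linarith, by linarith⟩).ne_empty⟩
  have h4 := measureReal_mono (μ := P) h3
  linarith

lemma real_hit_pos (hN : IsPoissonProcess P N M) {B : Set ℝ} (hB : MeasurableSet B)
    (hf : M B ≠ ∞) (hpos : M B ≠ 0) : 0 < P.real {ω | (N ω ∩ B).Nonempty} := by
  have : {ω | (N ω ∩ B).Nonempty} = (avoid N B)ᶜ := by
    ext ω
    simp [avoid, nonempty_iff_ne_empty]
  rw [this, probReal_compl_eq_one_sub (hN.measurableSet_avoid hB), hN.real_avoid hB hf]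
  simpa using ENNReal.toReal_pos hpos hf

lemma real_fills_pos (hN : IsPoissonProcess P N M) (hf : ∀ a b : ℝ, M (Ioo a b) ≠ ∞)
    (hpos : ∀ a b : ℝ, 0 ≤ a → a < b → M (Ioo a b) ≠ 0) {ℓ : ℝ} (hℓ : 0 < ℓ) (t : ℝ) :
    0 < P.real {ω | Fills ℓ t (N ω)} := by
  have h0 : 0 < P.real {ω | Fills ℓ 0 (N ω)} := by
    have := hN.real_hit_pos (measurableSet_Ioo (a := 0) (b := ℓ)) (hf _ _) (hpos _ _ le_rfl hℓ)
    simpa [Fills] using this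
  have h := hN.mul_prod_le_real_fills hf ℓ 0 t (half_pos hℓ)
  rw [zero_add] at h
  refine lt_of_lt_of_le (mul_pos h0 (Finset.prod_pos fun k _ => ?_)) h
  have hk : (0 : ℝ) ≤ k * (ℓ / 2) := by positivity
  have := ENNReal.toReal_pos (hpos (0 + k * (ℓ / 2)) (0 + k * (ℓ / 2) + ℓ - ℓ / 2)
    (by linarith) (by linarith)) (hf _ _)
  simpa using this

end IsPoissonProcess

end Poisson

/-! ### Masses of intervals under the intensity measure. -/

section Intensity

variable {μ : ℝ → ℝ}

lemma intensity_Ioo {a : ℝ} (ha : 0 ≤ a) (b : ℝ) :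
    intensity μ (Ioo a b) = ∫⁻ t in Ioo a b, ENNReal.ofReal (μ t) := by
  rw [intensity, withDensity_apply _ measurableSet_Ioo, Measure.restrict_restrict measurableSet_Ioo,
    inter_eq_left.2 (Ioo_subset_Ioi_self.trans (Ioi_subset_Ioi ha))]

lemma intensity_Ioo_ne_top (hM : ∀ t : ℝ, intensity μ (Ioo 0 t) < ∞) (a b : ℝ) :
    intensity μ (Ioo a b) ≠ ∞ := by
  have h0 : intensity μ (Iic 0) = 0 := by
    rw [intensity, withDensity_apply _ measurableSet_Iic,
      Measure.restrict_restrict measurableSet_Iic, Iic_inter_Ioi, Ioc_self, Measure.restrict_empty,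
      lintegral_zero_measure]
  have hsub : Ioo a b ⊆ Iic 0 ∪ Ioo 0 b := fun x hx =>
    (le_or_gt x 0).imp id fun h => ⟨h, hx.2⟩
  refine ((measure_mono hsub).trans (measure_union_le _ _)).trans_lt ?_ |>.ne
  rw [h0, zero_add]
  exact hM b

lemma intensity_Ioo_ne_zero (hμ_meas : Measurable μ)
    (hμ_pos : ∀ᵐ t ∂(volume.restrict (Ioi (0 : ℝ))), 0 < μ t) {a b : ℝ} (ha : 0 ≤ a)
    (hab : a < b) : intensity μ (Ioo a b) ≠ 0 := by
  rw [intensity_Ioo ha, ← pos_iff_ne_zero, lintegral_pos_iff_support hμ_meas.ennreal_ofReal]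
  have h : ∀ᵐ t ∂(volume.restrict (Ioo a b)), 0 < μ t :=
    ae_restrict_of_ae_restrict_of_subset (fun x hx => ha.trans_lt hx.1) hμ_pos
  have huniv : Function.support (fun t => ENNReal.ofReal (μ t)) =ᵐ[volume.restrict (Ioo a b)]
      (univ : Set ℝ) :=
    eventuallyEq_univ.2 (h.mono fun t ht => (ENNReal.ofReal_pos.2 ht).ne')
  rw [measure_congr huniv, Measure.restrict_apply_univ, Real.volume_Ioo]
  exact ENNReal.ofReal_pos.2 (sub_pos.2 hab)

lemma eventually_le_intensity (hμ : Tendsto μ atTop atTop) (c : ℝ) {r : ℝ} (hr : 0 < r) :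
    ∀ᶠ t in atTop, ENNReal.ofReal c ≤ intensity μ (Ioo t (t + r)) := by
  obtain ⟨T, hT⟩ := eventually_atTop.1 (hμ.eventually_ge_atTop (c / r))
  filter_upwards [eventually_ge_atTop T, eventually_ge_atTop 0] with t ht h0
  rw [intensity_Ioo h0]
  calc ENNReal.ofReal c = ∫⁻ _ in Ioo t (t + r), ENNReal.ofReal (c / r) := by
        rw [setLIntegral_const, Real.volume_Ioo, add_sub_cancel_left, ← ENNReal.ofReal_mul' hr.le,
          div_mul_cancel₀ _ hr.ne']
    _ ≤ _ := setLIntegral_mono' measurableSet_Ioo fun x hx =>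
        ENNReal.ofReal_le_ofReal (hT x (ht.trans hx.1.le))

lemma eventually_intensity_le (hμ : Tendsto μ atTop (𝓝 0)) {c : ℝ} (hc : 0 < c) {r : ℝ}
    (hr : 0 < r) : ∀ᶠ t in atTop, intensity μ (Ioo t (t + r)) ≤ ENNReal.ofReal c := by
  obtain ⟨T, hT⟩ := eventually_atTop.1 (hμ.eventually_le_const (div_pos hc hr))
  filter_upwards [eventually_ge_atTop T, eventually_ge_atTop 0] with t ht h0
  rw [intensity_Ioo h0]
  calc _ ≤ ∫⁻ _ in Ioo t (t + r), ENNReal.ofReal (c / r) :=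
        setLIntegral_mono' measurableSet_Ioo fun x hx =>
          ENNReal.ofReal_le_ofReal (hT x (ht.trans hx.1.le))
    _ = ENNReal.ofReal c := by
        rw [setLIntegral_const, Real.volume_Ioo, add_sub_cancel_left, ← ENNReal.ofReal_mul' hr.le,
          div_mul_cancel₀ _ hr.ne']

end Intensity

/-! ### Bounds on the tail ratio and the theorem. -/

namespace IsPoissonProcess

variable {Ω : Type*} [MeasurableSpace Ω] {P : Measure Ω} [IsProbabilityMeasure P]
  {N : Ω → Set ℝ} {M : Measure ℝ} {ℓ : ℝ}

lemma measure_lt_firstGap (hN : IsPoissonProcess P N M) (hf : ∀ a b : ℝ, M (Ioo a b) ≠ ∞)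
    (t : ℝ) :
    P {ω | (t : EReal) < firstGap ℓ (N ω)} = ENNReal.ofReal (P.real {ω | Fills ℓ t (N ω)}) := by
  rw [ofReal_measureReal]
  refine measure_congr (eventuallyEq_set.2 ?_)
  have hfin : ∀ᵐ ω ∂P, ∀ n : ℕ, (N ω ∩ Ioo 0 (n : ℝ)).Finite :=
    ae_all_iff.2 fun n => hN.ae_finite measurableSet_Ioo (hf _ _)
  filter_upwards [hfin] with ω hω
  exact ⟨fills_of_lt_firstGap (hN.subset_Ioi ω) hω, lt_firstGap_of_fills⟩

lemma tailRatio_eq (hN : IsPoissonProcess P N M) (hf : ∀ a b : ℝ, M (Ioo a b) ≠ ∞)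
    (hpos : ∀ a b : ℝ, 0 ≤ a → a < b → M (Ioo a b) ≠ 0) (hℓ : 0 < ℓ) (u t : ℝ) :
    tailRatio P N ℓ u t = ENNReal.ofReal
      (P.real {ω | Fills ℓ (t + u) (N ω)} / P.real {ω | Fills ℓ t (N ω)}) := by
  rw [tailRatio, hN.measure_lt_firstGap hf, hN.measure_lt_firstGap hf,
    ENNReal.ofReal_div_of_pos (hN.real_fills_pos hf hpos hℓ t)]

lemma tailRatio_le_one (hN : IsPoissonProcess P N M) (hf : ∀ a b : ℝ, M (Ioo a b) ≠ ∞)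
    (hpos : ∀ a b : ℝ, 0 ≤ a → a < b → M (Ioo a b) ≠ 0) (hℓ : 0 < ℓ) {u : ℝ} (hu : 0 ≤ u)
    (t : ℝ) : tailRatio P N ℓ u t ≤ 1 := by
  rw [hN.tailRatio_eq hf hpos hℓ, ENNReal.ofReal_le_one]
  exact div_le_one_of_le₀ (measureReal_mono fun ω h => Fills.anti (by linarith) h)
    measureReal_nonneg

lemma eventually_le_tailRatio (hN : IsPoissonProcess P N M) (hf : ∀ a b : ℝ, M (Ioo a b) ≠ ∞)
    (hpos : ∀ a b : ℝ, 0 ≤ a → a < b → M (Ioo a b) ≠ 0) (hℓ : 0 < ℓ) {ε c u : ℝ} (hε : 0 < ε)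
    (hc : 0 ≤ c) (h : ∀ᶠ t in atTop, ENNReal.ofReal c ≤ M (Ioo t (t + ℓ - ε))) :
    ∀ᶠ t in atTop,
      ENNReal.ofReal ((1 - Real.exp (-c)) ^ (⌈u / ε⌉₊ + 1)) ≤ tailRatio P N ℓ u t := by
  obtain ⟨T, hT⟩ := eventually_atTop.1 h
  filter_upwards [eventually_ge_atTop T] with t ht
  rw [hN.tailRatio_eq hf hpos hℓ]
  refine ENNReal.ofReal_le_ofReal ((le_div_iff₀ (hN.real_fills_pos hf hpos hℓ t)).2 ?_)
  rw [mul_comm]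
  refine le_trans (mul_le_mul_of_nonneg_left ?_ measureReal_nonneg)
    (hN.mul_prod_le_real_fills hf ℓ t u hε)
  have hc1 : 0 ≤ 1 - Real.exp (-c) := by simpa using hc
  have := Finset.prod_le_prod (s := Finset.range (⌈u / ε⌉₊ + 1))
    (f := fun _ => 1 - Real.exp (-c))
    (g := fun k : ℕ => 1 - Real.exp (-(M (Ioo (t + k * ε) (t + k * ε + ℓ - ε))).toReal))
    (fun _ _ => hc1) fun k _ => by
      have hk : T ≤ t + k * ε := ht.trans (le_add_of_nonneg_right (by positivity))
      have := (ENNReal.ofReal_le_iff_le_toReal (hf _ _)).1 (hT _ hk)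
      gcongr
  simpa using this

lemma eventually_tailRatio_le (hN : IsPoissonProcess P N M) (hf : ∀ a b : ℝ, M (Ioo a b) ≠ ∞)
    (hpos : ∀ a b : ℝ, 0 ≤ a → a < b → M (Ioo a b) ≠ 0) (hℓ : 0 < ℓ) {c u : ℝ} (hc : 0 ≤ c)
    (hu : ℓ ≤ u) (h : ∀ᶠ t in atTop, M (Ioo t (t + ℓ)) ≤ ENNReal.ofReal c) :
    ∀ᶠ t in atTop, tailRatio P N ℓ u t ≤ ENNReal.ofReal (1 - Real.exp (-c)) := by
  filter_upwards [(tendsto_atTop_add_const_right atTop ℓ tendsto_id).eventually h,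
    eventually_ge_atTop 0] with t ht h0
  rw [hN.tailRatio_eq hf hpos hℓ]
  refine ENNReal.ofReal_le_ofReal ((div_le_iff₀ (hN.real_fills_pos hf hpos hℓ t)).2 ?_)
  refine (hN.real_fills_add_le hf h0 hℓ hu).trans ?_
  rw [mul_comm]
  refine mul_le_mul_of_nonneg_right ?_ measureReal_nonneg
  have := ENNReal.toReal_le_of_le_ofReal hc ht
  simp only [id] at this
  gcongr

end IsPoissonProcess

theorem mainTheorem5 {Ω : Type*} [MeasurableSpace Ω] (P : Measure Ω) [IsProbabilityMeasure P]
    (ℓ : ℝ) (hℓ : 0 < ℓ)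
    (μ : ℝ → ℝ) (hμ_meas : Measurable μ)
    (hμ_pos : ∀ᵐ t ∂(volume.restrict (Ioi (0 : ℝ))), 0 < μ t)
    (hM : ∀ t : ℝ, intensity μ (Ioo 0 t) < ∞)
    (N : Ω → Set ℝ) (hN : IsPoissonProcess P N (intensity μ)) :
    -- the ratios below are well defined
    (∀ t : ℝ, 0 < P {ω | (t : EReal) < firstGap ℓ (N ω)}) ∧
    -- (i)
    (Tendsto μ atTop atTop →
      ∀ u : ℝ, 0 < u → Tendsto (fun t => tailRatio P N ℓ u t) atTop (𝓝 1)) ∧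
    ((∃ ε : ℝ, 0 < ε ∧ 0 < liminf (fun t : ℝ => intensity μ (Ioo t (t + ℓ - ε))) atTop) →
      ∀ u : ℝ, 0 < u → 0 < liminf (fun t => tailRatio P N ℓ u t) atTop) ∧
    -- (ii)
    (Tendsto μ atTop (𝓝 0) →
      ∀ u : ℝ, ℓ ≤ u → Tendsto (fun t => tailRatio P N ℓ u t) atTop (𝓝 0)) ∧
    (limsup (fun t : ℝ => intensity μ (Ioo t (t + ℓ))) atTop < ∞ →
      ∀ u : ℝ, ℓ ≤ u → limsup (fun t => tailRatio P N ℓ u t) atTop < 1) := by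
  have hf := intensity_Ioo_ne_top hM
  have hpos := fun a b : ℝ => intensity_Ioo_ne_zero (a := a) (b := b) hμ_meas hμ_pos
  refine ⟨fun t => ?_, fun hμ u hu => ?_, ?_, fun hμ u hu => ?_, fun hlim u hu => ?_⟩
  · rw [hN.measure_lt_firstGap hf]
    exact ENNReal.ofReal_pos.2 (hN.real_fills_pos hf hpos hℓ t)
  · refine tendsto_order.2 ⟨fun a ha => ?_, fun a ha =>
      Eventually.of_forall fun t => (hN.tailRatio_le_one hf hpos hℓ hu.le t).trans_lt ha⟩
    -- With `ε = ℓ / 2` fixed the exponent is fixed, so a large `c` brings the lower bound above any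
    -- `a < 1`.
    have hexp : Tendsto (fun c => ENNReal.ofReal ((1 - Real.exp (-c)) ^ (⌈u / (ℓ / 2)⌉₊ + 1)))
        atTop (𝓝 1) := by
      have := ((Real.tendsto_exp_neg_atTop_nhds_zero.const_sub 1).pow (⌈u / (ℓ / 2)⌉₊ + 1))
      simpa using ENNReal.tendsto_ofReal this
    obtain ⟨c, hac, hc⟩ := ((hexp.eventually_const_lt ha).and (eventually_ge_atTop 0)).exists
    have h := eventually_le_intensity hμ c (half_pos hℓ)
    have h' : ∀ᶠ t in atTop, ENNReal.ofReal c ≤ intensity μ (Ioo t (t + ℓ - ℓ / 2)) :=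
      h.mono fun t ht => by rwa [add_sub_assoc, sub_half]
    exact (hN.eventually_le_tailRatio hf hpos hℓ (half_pos hℓ) hc h').mono
      fun t ht => hac.trans_le ht
  · rintro ⟨ε, hε, hlim⟩ u -
    obtain ⟨c, hc0, hc⟩ := exists_between hlim
    have hct : c ≠ ∞ := hc.ne_top
    have hcpos := ENNReal.toReal_pos hc0.ne' hct
    have h : ∀ᶠ t in atTop, ENNReal.ofReal c.toReal ≤ intensity μ (Ioo t (t + ℓ - ε)) :=
      (eventually_lt_of_lt_liminf hc).mono fun t ht => by
        rw [ENNReal.ofReal_toReal hct]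
        exact ht.le
    refine lt_of_lt_of_le (ENNReal.ofReal_pos.2 (pow_pos ?_ _)) (le_liminf_of_le (by isBoundedDefault)
      (hN.eventually_le_tailRatio hf hpos hℓ hε hcpos.le h (u := u)))
    simpa using hcpos
  · refine ENNReal.tendsto_nhds_zero.2 fun a ha => ?_
    have hexp : Tendsto (fun c : ℝ => ENNReal.ofReal (1 - Real.exp (-c))) (𝓝[>] 0) (𝓝 0) := by
      have : Continuous fun c : ℝ => ENNReal.ofReal (1 - Real.exp (-c)) :=
        ENNReal.continuous_ofReal.comp (by fun_prop)
      simpa using (this.tendsto 0).mono_left nhdsWithin_le_nhds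
    obtain ⟨c, hca, hc⟩ :=
      ((hexp.eventually_lt_const ha).and eventually_mem_nhdsWithin).exists
    exact (hN.eventually_tailRatio_le hf hpos hℓ (le_of_lt hc) hu
      (eventually_intensity_le hμ hc hℓ)).mono fun t ht => ht.trans hca.le
  · obtain ⟨c, hc, hct⟩ := exists_between hlim
    have h : ∀ᶠ t in atTop, intensity μ (Ioo t (t + ℓ)) ≤ ENNReal.ofReal c.toReal :=
      (eventually_lt_of_limsup_lt hc).mono fun t ht => by
        rw [ENNReal.ofReal_toReal hct.ne]
        exact ht.le
    refine (limsup_le_of_le (by isBoundedDefault)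
      (hN.eventually_tailRatio_le hf hpos hℓ ENNReal.toReal_nonneg hu h)).trans_lt ?_
    rw [ENNReal.ofReal_lt_one]
    linarith [Real.exp_pos (-c.toReal)]
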